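/- Let $\mathbb Z_+=\{0,1,2,\dots\}$. A commuting $2$-variable weighted shift $W_{(\alpha,\beta)}\equiv(T_1,T_2)$ on $\ell^2(\mathbb Z_+^2)$ is given by bounded families of positive weights with $\beta_{\mathbf k+\varepsilon_1}\alpha_{\mathbf k}=\alpha_{\mathbf k+\varepsilon_2}\beta_{\mathbf k}$ through $T_1e_{\mathbf k}=\alpha_{\mathbf k}e_{\mathbf k+\varepsilon_1}$ and $T_2e_{\mathbf k}=\beta_{\mathbf k}e_{\mathbf k+\varepsilon_2}$. Its moments are $\gamma_{(k_1,k_2)}=\prod_{i<k_1}\alpha_{(i,0)}^2\prod_{j<k_2}\beta_{(k_1,j)}^2$, and a Berger measure of $W_{(\alpha,\beta)}$ is a Borel probability measure $\mu$ on $[0,\|T_1\|^2]\times[0,\|T_2\|^2]\subseteq\mathbb R^2$ with $\gamma_{(k_1,k_2)}=\int s^{k_1}t^{k_2}\,d\mu(s,t)$ for all $k_1,k_2\ge 0$. Berger measures of unilateral weighted shifts are defined in the same way. If a unilateral weighted shift $W_\omega$ has a Berger measure $\sigma$ carried by $[0,1]$, then its spherically isometric embedding $\mathcal{SIE}(W_\omega)$,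 if it exists, is the commuting $2$-variable weighted shift with moments $\gamma_{(k_1,k_2)}=\int_{[0,1]}r^{k_1}(1-r)^{k_2}\,d\sigma(r)$. **Theorem.** Let $B_+=\mathrm{shift}\bigl(\sqrt{1/2},\sqrt{2/3},\sqrt{3/4},\dots\bigr)$ be the Bergman shift. Then: 1. $\mathcal{SIE}(B_+)\equiv(T_1,T_2)$ exists and is unique. It is a spherical isometry ($T_1^*T_1+T_2^*T_2=I$) whose $0$-th row $(\alpha_{(n,0)})_{n\ge 0}$ is the weight sequence of $B_+$, and it is the only commuting $2$-variable weighted shift with these two properties. 2. Its moments are $\gamma_{(k_1,k_2)}=\dfrac{k_1!\,k_2!}{(k_1+k_2+1)!}$ for all $k_1,k_2\ge 0$. 3. It has exactly one Berger measure, namely normalized arclength on the line segment $\{(r,1-r):0\le r\le 1\}\subseteq\mathbb R^2$. 4. It is unitarily equivalent (both components by one and the same unitary) to the pair $(M_{z_1},M_{z_2})$ of multiplication operators by the coordinate functions on the Hardy space of the unit sphere of $\mathbb C^2$, that is, the closure of the polynomials in $z_1,z_2$ in $L^2$ of the normalized surface measure of the sphere. -/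

import Mathlib

open MeasureTheory Set
open scoped ENNReal

noncomputable section

namespace BergmanSIE

/-! ### Weighted shifts on `ℓ²(ι)` -/

/-- Square-summability of the image of `x` under a weighted shift, with the exact value of the sum
of squares. -/
lemma hasSum_extend_sq {ι : Type*} (s : ι → ι) (hs : Function.Injective s) (w : ι → ℝ) (C : ℝ)
    (hw : ∀ i, |w i| ≤ C) (x : lp (fun _ : ι => ℂ) 2) :
    ∃ S : ℝ, S ≤ C ^ 2 * ‖x‖ ^ 2 ∧
      HasSum (fun j => ‖Function.extend s (fun i => (w i : ℂ) * x i) 0 j‖ ^ 2) S := by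
  have hx : HasSum (fun i => ‖x i‖ ^ 2) (‖x‖ ^ 2) := by
    have h := lp.hasSum_norm (p := 2) (by norm_num) x
    simpa using h
  have hle : ∀ i, ‖(w i : ℂ) * x i‖ ^ 2 ≤ C ^ 2 * ‖x i‖ ^ 2 := by
    intro i
    rw [norm_mul, mul_pow, Complex.norm_real, Real.norm_eq_abs]
    have h0 := hw i
    have h1 := abs_nonneg (w i)
    gcongr
  have hsum : Summable fun i => ‖(w i : ℂ) * x i‖ ^ 2 :=
    Summable.of_nonneg_of_le (fun i => by positivity) hle (hx.mul_left (C ^ 2)).summable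
  refine ⟨∑' i, ‖(w i : ℂ) * x i‖ ^ 2, hasSum_le hle hsum.hasSum (hx.mul_left (C ^ 2)), ?_⟩
  rw [← hs.hasSum_iff]
  · convert hsum.hasSum using 1
    funext i
    simp [hs.extend_apply]
  · intro j hj
    rw [Function.extend_apply' _ _ _ (fun ⟨a, ha⟩ => hj ⟨a, ha⟩)]
    simp

/-- The bounded operator on `ℓ²(ι)` determined by `e_i ↦ w i • e_{s i}`, for an injective map
`s : ι → ι` and bounded real weights `w`: the `j`-th coordinate of the image of `x` is `w i * x i`
if `j = s i`, and `0` if `j` is not in the range of `s`. -/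
def shiftOperator {ι : Type*} (s : ι → ι) (hs : Function.Injective s) (w : ι → ℝ)
    (hw : ∃ C : ℝ, ∀ i, |w i| ≤ C) : lp (fun _ : ι => ℂ) 2 →L[ℂ] lp (fun _ : ι => ℂ) 2 :=
  LinearMap.mkContinuousOfExistsBound
    { toFun := fun x => ⟨Function.extend s (fun i => (w i : ℂ) * x i) 0, by
        obtain ⟨C, hC⟩ := hw
        obtain ⟨S, -, hS⟩ := hasSum_extend_sq s hs w C hC x
        refine (memℓp_gen_iff (p := 2) (by norm_num)).2 ?_
        simpa using hS.summable⟩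
      map_add' := fun x y => by
        ext j
        by_cases hj : ∃ i, s i = j
        · obtain ⟨i, rfl⟩ := hj
          change Function.extend s (fun i => (w i : ℂ) * (x i + y i)) 0 (s i) =
            Function.extend s (fun i => (w i : ℂ) * x i) 0 (s i) +
              Function.extend s (fun i => (w i : ℂ) * y i) 0 (s i)
          simp [hs.extend_apply, mul_add]
        · change Function.extend s (fun i => (w i : ℂ) * (x i + y i)) 0 j =
            Function.extend s (fun i => (w i : ℂ) * x i) 0 j +
              Function.extend s (fun i => (w i : ℂ) * y i) 0 j
          simp [Function.extend_apply' _ _ _ hj]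
      map_smul' := fun c x => by
        ext j
        by_cases hj : ∃ i, s i = j
        · obtain ⟨i, rfl⟩ := hj
          simp [hs.extend_apply, mul_left_comm]
        · simp [Function.extend_apply' _ _ _ hj] }
    (by
      obtain ⟨C, hC⟩ := hw
      refine ⟨|C|, fun x => ?_⟩
      obtain ⟨S, hle, hS⟩ := hasSum_extend_sq s hs w C hC x
      set y : lp (fun _ : ι => ℂ) 2 := _
      change ‖y‖ ≤ _
      have hy : HasSum (fun i => ‖y i‖ ^ 2) (‖y‖ ^ 2) := by
        have h := lp.hasSum_norm (p := 2) (by norm_num) y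
        simpa using h
      have hyS : ‖y‖ ^ 2 = S := hy.unique hS
      refine le_of_sq_le_sq ?_ (by positivity)
      rw [hyS, mul_pow, sq_abs]
      exact hle)

/-- The defining relation `T e_i = w i • e_{s i}`. -/
lemma shiftOperator_single {ι : Type*} [DecidableEq ι] (s : ι → ι) (hs : Function.Injective s)
    (w : ι → ℝ) (hw : ∃ C : ℝ, ∀ i, |w i| ≤ C) (i : ι) :
    shiftOperator s hs w hw (lp.single 2 i (1 : ℂ)) = (w i : ℂ) • lp.single 2 (s i) (1 : ℂ) := by
  ext j
  change Function.extend s (fun k => (w k : ℂ) * (lp.single 2 i (1 : ℂ) :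
    lp (fun _ : ι => ℂ) 2) k) 0 j = (w i : ℂ) * (lp.single 2 (s i) (1 : ℂ) :
    lp (fun _ : ι => ℂ) 2) j
  by_cases hj : ∃ k, s k = j
  · obtain ⟨k, rfl⟩ := hj
    by_cases hk : k = i
    · subst hk
      simp [hs.extend_apply]
    · have h2 : s k ≠ s i := fun h => hk (hs h)
      simp [hs.extend_apply, hk, h2]
  · have h2 : j ≠ s i := fun h => hj ⟨i, h.symm⟩
    simp [Function.extend_apply' _ _ _ hj, h2]

/-- A unilateral weighted shift `shift(ω₀, ω₁, …)`, given by a bounded sequence of positive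
weights. -/
@[ext]
structure UnilateralWeightedShift where
  weight : ℕ → ℝ
  pos : ∀ n, 0 < weight n
  bdd : ∃ C : ℝ, ∀ n, |weight n| ≤ C

namespace UnilateralWeightedShift

variable (w : UnilateralWeightedShift)

/-- The operator `W_ω e_n = ω_n e_{n+1}` on `ℓ²(ℤ₊)`. -/
def op : lp (fun _ : ℕ => ℂ) 2 →L[ℂ] lp (fun _ : ℕ => ℂ) 2 :=
  shiftOperator (fun n => n + 1) (add_left_injective 1) w.weight w.bdd

/-- The moments `γ_k = ω₀² ⋯ ω_{k-1}²`. -/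
def moment (k : ℕ) : ℝ := ∏ i ∈ Finset.range k, w.weight i ^ 2

/-- `σ` is a Berger measure of `W_ω`: a probability measure carried by `[0, ‖W_ω‖²]` whose moments
are those of `W_ω`. -/
def IsBergerMeasure (σ : Measure ℝ) : Prop :=
  IsProbabilityMeasure σ ∧ σ (Icc 0 (‖w.op‖ ^ 2))ᶜ = 0 ∧ ∀ k, w.moment k = ∫ t, t ^ k ∂σ

end UnilateralWeightedShift

/-- A commuting `2`-variable weighted shift `W_(α,β)`, given by bounded double-indexed families of
positive weights which satisfy `β_{k+ε₁} α_k = α_{k+ε₂} β_k`, the condition equivalent to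
`T₁T₂ = T₂T₁`. -/
@[ext]
structure TwoVariableWeightedShift where
  α : ℕ × ℕ → ℝ
  β : ℕ × ℕ → ℝ
  α_pos : ∀ k, 0 < α k
  β_pos : ∀ k, 0 < β k
  α_bdd : ∃ C : ℝ, ∀ k, |α k| ≤ C
  β_bdd : ∃ C : ℝ, ∀ k, |β k| ≤ C
  comm : ∀ k, β (k + (1, 0)) * α k = α (k + (0, 1)) * β k

namespace TwoVariableWeightedShift

variable (W : TwoVariableWeightedShift)

/-- The operator `T₁ e_k = α_k e_{k+ε₁}` on `ℓ²(ℤ₊²)`. -/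
def T₁ : lp (fun _ : ℕ × ℕ => ℂ) 2 →L[ℂ] lp (fun _ : ℕ × ℕ => ℂ) 2 :=
  shiftOperator (fun k => k + (1, 0)) (add_left_injective _) W.α W.α_bdd

/-- The operator `T₂ e_k = β_k e_{k+ε₂}` on `ℓ²(ℤ₊²)`. -/
def T₂ : lp (fun _ : ℕ × ℕ => ℂ) 2 →L[ℂ] lp (fun _ : ℕ × ℕ => ℂ) 2 :=
  shiftOperator (fun k => k + (0, 1)) (add_left_injective _) W.β W.β_bdd

/-- The moments
`γ_k = α_{(0,0)}² ⋯ α_{(k₁-1,0)}² β_{(k₁,0)}² ⋯ β_{(k₁,k₂-1)}²`. -/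
def moment (k : ℕ × ℕ) : ℝ :=
  (∏ i ∈ Finset.range k.1, W.α (i, 0) ^ 2) * ∏ j ∈ Finset.range k.2, W.β (k.1, j) ^ 2

/-- `W_(α,β)` is a spherical isometry: `T₁* T₁ + T₂* T₂ = I`. -/
def IsSphericalIsometry : Prop :=
  ContinuousLinearMap.adjoint W.T₁ ∘L W.T₁ + ContinuousLinearMap.adjoint W.T₂ ∘L W.T₂ =
    ContinuousLinearMap.id ℂ (lp (fun _ : ℕ × ℕ => ℂ) 2)

/-- `μ` is a Berger measure of `W_(α,β)`: a probability measure on the Euclidean plane carried by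
the rectangle `[0, ‖T₁‖²] × [0, ‖T₂‖²]` whose moments are those of `W_(α,β)`. -/
def IsBergerMeasure (μ : Measure (EuclideanSpace ℝ (Fin 2))) : Prop :=
  IsProbabilityMeasure μ ∧
    μ {x | x 0 ∈ Icc 0 (‖W.T₁‖ ^ 2) ∧ x 1 ∈ Icc 0 (‖W.T₂‖ ^ 2)}ᶜ = 0 ∧
    ∀ k : ℕ × ℕ, W.moment k = ∫ x, x 0 ^ k.1 * x 1 ^ k.2 ∂μ

end TwoVariableWeightedShift

/-! ### Polynomial embeddings and the Bergman shift -/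

/-- `W` is the `(p,q)`-embedding of the subnormal shift `W_ω` over the interval `[a,b] ⊆ ℝ₊`:
`p` and `q` are nonnegative on `[a,b]`, the map `r ↦ (p(r), q(r))` is injective on `[a,b]`, the
Berger measure `σ` of `W_ω` is carried by `[a,b]`, and
`γ_{(k₁,k₂)}(W) = ∫ p(r)^{k₁} q(r)^{k₂} dσ(r)`. -/
def IsPolynomialEmbedding (w : UnilateralWeightedShift) (p q : Polynomial ℝ) (a b : ℝ)
    (W : TwoVariableWeightedShift) : Prop :=
  0 ≤ a ∧ (∀ r ∈ Icc a b, 0 ≤ p.eval r ∧ 0 ≤ q.eval r) ∧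
    InjOn (fun r => (p.eval r, q.eval r)) (Icc a b) ∧
    ∃ σ : Measure ℝ, w.IsBergerMeasure σ ∧ σ (Icc a b)ᶜ = 0 ∧
      ∀ k : ℕ × ℕ, W.moment k = ∫ r in Icc a b, p.eval r ^ k.1 * q.eval r ^ k.2 ∂σ

/-- `W` is the spherically isometric embedding of `W_ω`: the `(p,q)`-embedding with `p(r) = r` and
`q(r) = 1 - r` on `[0,1]`. -/
def IsSphericallyIsometricEmbedding (w : UnilateralWeightedShift)
    (W : TwoVariableWeightedShift) : Prop :=
  IsPolynomialEmbedding w Polynomial.X (1 - Polynomial.X) 0 1 W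

/-- The Bergman shift `B₊`, with weights `ω_n = √((n+1)/(n+2))`. -/
def bergmanShift : UnilateralWeightedShift where
  weight n := √(((n : ℝ) + 1) / ((n : ℝ) + 2))
  pos n := by positivity
  bdd := ⟨1, fun n => by
    rw [abs_of_nonneg (Real.sqrt_nonneg _), Real.sqrt_le_one, div_le_one (by positivity)]
    linarith⟩

/-- The line segment `{(r, 1-r) : 0 ≤ r ≤ 1}` in the Euclidean plane. -/
def unitSegment : Set (EuclideanSpace ℝ (Fin 2)) := (fun r : ℝ => !₂[r, 1 - r]) '' Icc 0 1

/-- Normalized arclength on a subset `L` of the Euclidean plane: the one-dimensional Hausdorff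
measure on `L`, divided by its total mass. -/
def normalizedArclength (L : Set (EuclideanSpace ℝ (Fin 2))) :
    Measure (EuclideanSpace ℝ (Fin 2)) :=
  (μH[1] L)⁻¹ • (μH[1] : Measure (EuclideanSpace ℝ (Fin 2))).restrict L

/-! ### The Hardy space of the unit sphere of `ℂ²` -/

/-- The unit sphere of `ℂ²`. -/
abbrev Sphere : Type := Metric.sphere (0 : EuclideanSpace ℂ (Fin 2)) 1

/-- The normalized surface measure on the unit sphere of `ℂ²`. -/
def surfaceMeasure : Measure Sphere :=
  ((volume : Measure (EuclideanSpace ℂ (Fin 2))).toSphere univ)⁻¹ •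
    (volume : Measure (EuclideanSpace ℂ (Fin 2))).toSphere

instance : IsFiniteMeasure surfaceMeasure := by
  unfold surfaceMeasure
  have h : (volume : Measure (EuclideanSpace ℂ (Fin 2))).toSphere ≠ 0 := Measure.toSphere_ne_zero _
  refine ⟨?_⟩
  rw [Measure.smul_apply, smul_eq_mul]
  refine ENNReal.mul_lt_top ?_ (measure_lt_top _ _)
  exact ENNReal.inv_lt_top.2 (pos_iff_ne_zero.2 (Measure.measure_univ_ne_zero.2 h))

/-- The coordinate function `z_i` on the sphere. -/
def coord (i : Fin 2) : C(Sphere, ℂ) := ⟨fun z => (z : EuclideanSpace ℂ (Fin 2)) i, by fun_prop⟩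

/-- The linear map which sends a polynomial in `z₁, z₂` to the class in `L²` of its restriction to
the sphere. -/
def polyToL2 : MvPolynomial (Fin 2) ℂ →ₗ[ℂ] Lp ℂ 2 surfaceMeasure :=
  (ContinuousMap.toLp (E := ℂ) 2 surfaceMeasure ℂ).toLinearMap ∘ₗ
    (MvPolynomial.aeval coord).toLinearMap

/-- The Hardy space of the unit sphere: the closure in `L²` of the analytic polynomials. -/
def hardySpace : Submodule ℂ (Lp ℂ 2 surfaceMeasure) :=
  (LinearMap.range polyToL2).topologicalClosure

/-- Multiplication by `z_i` on `L²` of the sphere. -/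
def mulCoordL2 (i : Fin 2) : Lp ℂ 2 surfaceMeasure →L[ℂ] Lp ℂ 2 surfaceMeasure :=
  (ContinuousLinearMap.mul ℂ ℂ).holderL surfaceMeasure ∞ 2 2
    (ContinuousMap.toLp (E := ℂ) ∞ surfaceMeasure ℂ (coord i))

lemma mulCoordL2_ae (i : Fin 2) (f : Lp ℂ 2 surfaceMeasure) :
    mulCoordL2 i f =ᵐ[surfaceMeasure]
      fun z => (z : EuclideanSpace ℂ (Fin 2)) i * f z := by
  have h1 := (ContinuousLinearMap.mul ℂ ℂ).coeFn_holder (r := 2)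
    (ContinuousMap.toLp (E := ℂ) ∞ surfaceMeasure ℂ (coord i)) f
  have h2 := ContinuousMap.coeFn_toLp (p := ∞) (𝕜 := ℂ) surfaceMeasure (coord i)
  filter_upwards [h1, h2] with z hz1 hz2
  change ((ContinuousLinearMap.mul ℂ ℂ).holder 2
    (ContinuousMap.toLp (E := ℂ) ∞ surfaceMeasure ℂ (coord i)) f : Sphere → ℂ) z = _
  rw [hz1, hz2]
  rfl

lemma mulCoordL2_polyToL2 (i : Fin 2) (p : MvPolynomial (Fin 2) ℂ) :
    mulCoordL2 i (polyToL2 p) = polyToL2 (MvPolynomial.X i * p) := by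
  have h1 := ContinuousMap.coeFn_toLp (p := 2) (𝕜 := ℂ) surfaceMeasure
    (MvPolynomial.aeval coord p)
  have h2 := ContinuousMap.coeFn_toLp (p := 2) (𝕜 := ℂ) surfaceMeasure
    (MvPolynomial.aeval coord (MvPolynomial.X i * p))
  refine Lp.ext ?_
  filter_upwards [mulCoordL2_ae i (polyToL2 p), h1, h2] with z hz hz1 hz2
  rw [hz]
  change _ * (ContinuousMap.toLp (E := ℂ) 2 surfaceMeasure ℂ
    (MvPolynomial.aeval coord p) : Sphere → ℂ) z = (ContinuousMap.toLp (E := ℂ) 2 surfaceMeasure ℂ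
    (MvPolynomial.aeval coord (MvPolynomial.X i * p)) : Sphere → ℂ) z
  rw [hz1, hz2]
  simp [coord]

lemma mulCoordL2_mem (i : Fin 2) (f : hardySpace) :
    mulCoordL2 i (f : Lp ℂ 2 surfaceMeasure) ∈ hardySpace := by
  have h : MapsTo (mulCoordL2 i) (LinearMap.range polyToL2 : Set (Lp ℂ 2 surfaceMeasure))
      (LinearMap.range polyToL2 : Set (Lp ℂ 2 surfaceMeasure)) := by
    rintro _ ⟨p, rfl⟩
    exact ⟨MvPolynomial.X i * p, (mulCoordL2_polyToL2 i p).symm⟩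
  exact h.closure (mulCoordL2 i).continuous f.2

/-- The multiplication operator `M_{z_i}` on the Hardy space of the unit sphere. -/
def mulCoord (i : Fin 2) : hardySpace →L[ℂ] hardySpace :=
  ((mulCoordL2 i).comp hardySpace.subtypeL).codRestrict hardySpace (mulCoordL2_mem i)

/-- The pairs `(A₁, A₂)` and `(B₁, B₂)` are unitarily equivalent: one and the same unitary
intertwines `A₁` with `B₁` and `A₂` with `B₂`. -/
def UnitarilyEquivalentPairs {H K : Type*} [NormedAddCommGroup H] [InnerProductSpace ℂ H]
    [NormedAddCommGroup K] [InnerProductSpace ℂ K] (A₁ A₂ : H →L[ℂ] H) (B₁ B₂ : K →L[ℂ] K) :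
    Prop :=
  ∃ U : H ≃ₗᵢ[ℂ] K, (∀ x, U (A₁ x) = B₁ (U x)) ∧ ∀ x, U (A₂ x) = B₂ (U x)

end BergmanSIE

end

noncomputable section

namespace BergmanSIE

/-! ### Coordinates, inner products and norms of weighted shifts -/

section ShiftOperator

variable {ι : Type*} (s : ι → ι) (hs : Function.Injective s) (w : ι → ℝ)
  (hw : ∃ C : ℝ, ∀ i, |w i| ≤ C)

/-! Everything is read off from moments. Consecutive moments have ratio `α_k²` or `β_k²`, so the
moments determine the shift (`ext_of_moment`). A spherical isometry is one with `α_k² + β_k² = 1`,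
that is, `γ_k = γ_{k+ε₁} + γ_{k+ε₂}`; this recursion yields each row from the one below it, so the
`0`-th row determines everything. Since `r + (1 - r) = 1`, the integrals of `r^m (1-r)^n` obey the
same recursion. Hence the spherically isometric embedding and the spherical isometry over the
Bergman shift are the same object, `bergmanSphericalShift`.

The image of Lebesgue measure on `[0,1]` under `r ↦ (r, 1-r)` has the right moments. No other
measure on the rectangle does, because polynomials separate finite measures on a compact set
(`ext_of_moments_of_isCompact`).

For the Hardy space, the monomials `z^k` must be shown orthogonal with squared norm `γ_k`. A
monomial in `z` and its conjugate, times a Gaussian on `ℂ²`, is integrated in two ways: polar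
coordinates give the sphere integral times a Gamma value; Fubini gives a product of integrals over
`ℂ`, which vanish off the diagonal by rotation and equal `π a!` on it. Total mass `1` fixes the
remaining constant. Multiplication by `z_i` then acts on normalized monomials with factor
`√(γ_{k+ε_i}/γ_k)`, which is the weight. -/

lemma shiftOperator_apply (x : lp (fun _ : ι => ℂ) 2) (i : ι) :
    shiftOperator s hs w hw x (s i) = (w i : ℂ) * x i := by
  change Function.extend s (fun k => (w k : ℂ) * x k) 0 (s i) = _
  rw [hs.extend_apply]

lemma shiftOperator_apply_of_notMem_range (x : lp (fun _ : ι => ℂ) 2) {j : ι}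
    (hj : j ∉ range s) : shiftOperator s hs w hw x j = 0 := by
  change Function.extend s (fun k => (w k : ℂ) * x k) 0 j = 0
  rw [Function.extend_apply' _ _ _ fun ⟨a, ha⟩ => hj ⟨a, ha⟩]
  rfl

/-- By injectivity of `s`, `T* T` is diagonal with entries `w i ^ 2`; this is the sesquilinear form
of that fact, which avoids computing the adjoint. -/
lemma hasSum_inner_shiftOperator (x y : lp (fun _ : ι => ℂ) 2) :
    HasSum (fun i => ((w i ^ 2 : ℝ) : ℂ) * inner ℂ (x i) (y i))
      (inner ℂ (shiftOperator s hs w hw x) (shiftOperator s hs w hw y)) := by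
  have h := lp.hasSum_inner (𝕜 := ℂ) (shiftOperator s hs w hw x) (shiftOperator s hs w hw y)
  rw [← hs.hasSum_iff] at h
  · refine (congrArg (fun f => HasSum f _) (funext fun i => ?_)).mp h
    simp only [Function.comp_apply, shiftOperator_apply, RCLike.inner_apply, map_mul,
      Complex.conj_ofReal]
    push_cast
    ring
  · intro j hj
    simp [shiftOperator_apply_of_notMem_range s hs w hw _ hj]

lemma norm_shiftOperator_le {C : ℝ} (hC : 0 ≤ C) (h : ∀ i, |w i| ≤ C) :
    ‖shiftOperator s hs w hw‖ ≤ C := by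
  refine ContinuousLinearMap.opNorm_le_bound _ hC fun x => ?_
  obtain ⟨S, hle, hS⟩ := hasSum_extend_sq s hs w C h x
  have hy : HasSum (fun i => ‖shiftOperator s hs w hw x i‖ ^ 2)
      (‖shiftOperator s hs w hw x‖ ^ 2) := by
    simpa using lp.hasSum_norm (p := 2) (by norm_num) (shiftOperator s hs w hw x)
  have hyS : ‖shiftOperator s hs w hw x‖ ^ 2 = S := hy.unique hS
  refine le_of_sq_le_sq ?_ (by positivity)
  rw [hyS, mul_pow]
  exact hle

lemma abs_weight_le_norm_shiftOperator (i : ι) : |w i| ≤ ‖shiftOperator s hs w hw‖ := by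
  classical
  have h := (shiftOperator s hs w hw).le_opNorm (lp.single 2 i (1 : ℂ))
  rw [shiftOperator_single, norm_smul, lp.norm_single (by norm_num),
    lp.norm_single (by norm_num)] at h
  simpa using h

/-- The carrier of a Berger measure is defined through operator norms, so these must be known
exactly. The norm is the supremum of the weights, here a limit along a sequence of indices. -/
lemma norm_shiftOperator_eq_one (h : ∀ i, |w i| ≤ 1) (u : ℕ → ι)
    (hu : Filter.Tendsto (fun n => w (u n)) Filter.atTop (nhds 1)) :
    ‖shiftOperator s hs w hw‖ = 1 :=
  le_antisymm (norm_shiftOperator_le s hs w hw zero_le_one h)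
    (le_of_tendsto' hu fun n =>
      (le_abs_self _).trans (abs_weight_le_norm_shiftOperator s hs w hw (u n)))

end ShiftOperator

namespace TwoVariableWeightedShift

variable (W W' : TwoVariableWeightedShift)

/-! ### Moments of two-variable weighted shifts -/

lemma moment_pos (k : ℕ × ℕ) : 0 < W.moment k :=
  mul_pos (Finset.prod_pos fun _ _ => pow_pos (W.α_pos _) 2)
    (Finset.prod_pos fun _ _ => pow_pos (W.β_pos _) 2)

lemma moment_add_snd (k : ℕ × ℕ) : W.moment (k + (0, 1)) = W.β k ^ 2 * W.moment k := by
  obtain ⟨m, n⟩ := k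
  simp only [moment, Prod.mk_add_mk, add_zero, Finset.prod_range_succ]
  ring

/-- The moment is defined along the path that goes right and then up, so this direction needs the
commutation relation to move a horizontal step down to the `0`-th row. -/
lemma moment_add_fst (k : ℕ × ℕ) : W.moment (k + (1, 0)) = W.α k ^ 2 * W.moment k := by
  obtain ⟨m, n⟩ := k
  induction n with
  | zero =>
    simp only [moment, Prod.mk_add_mk, add_zero, Finset.prod_range_succ, Finset.prod_range_zero]
    ring
  | succ n ih =>
    have h1 := W.moment_add_snd (m + 1, n)
    have h2 := W.moment_add_snd (m, n)
    have h3 := W.comm (m, n)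
    simp only [Prod.mk_add_mk, add_zero] at h1 h2 h3 ih ⊢
    rw [h1, h2, ih]
    -- The squared commutation relation: a difference of squares is the sum times the difference.
    linear_combination (W.β (m + 1, n) * W.α (m, n) + W.α (m, n + 1) * W.β (m, n)) *
      W.moment (m, n) * h3

variable {W W'}

/-- Ratios of neighbouring moments give the squared weights, and positivity selects the root. -/
lemma ext_of_moment (h : ∀ k, W.moment k = W'.moment k) : W = W' := by
  refine TwoVariableWeightedShift.ext (funext fun k => ?_) (funext fun k => ?_)
  · have h1 := W.moment_add_fst k
    rw [h, h, W'.moment_add_fst] at h1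
    exact ((pow_left_inj₀ (W'.α_pos k).le (W.α_pos k).le two_ne_zero).1
      (mul_right_cancel₀ (W'.moment_pos k).ne' h1)).symm
  · have h1 := W.moment_add_snd k
    rw [h, h, W'.moment_add_snd] at h1
    exact ((pow_left_inj₀ (W'.β_pos k).le (W.β_pos k).le two_ne_zero).1
      (mul_right_cancel₀ (W'.moment_pos k).ne' h1)).symm

/-! ### Spherical isometries -/

lemma hasSum_inner_T (x y : lp (fun _ : ℕ × ℕ => ℂ) 2) :
    HasSum (fun k => ((W.α k ^ 2 + W.β k ^ 2 : ℝ) : ℂ) * inner ℂ (x k) (y k))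
      (inner ℂ ((ContinuousLinearMap.adjoint W.T₁ ∘L W.T₁ +
        ContinuousLinearMap.adjoint W.T₂ ∘L W.T₂) x) y) := by
  have h := (hasSum_inner_shiftOperator _ (add_left_injective ((1, 0) : ℕ × ℕ)) W.α W.α_bdd
    x y).add (hasSum_inner_shiftOperator _ (add_left_injective ((0, 1) : ℕ × ℕ)) W.β W.β_bdd x y)
  convert h using 1
  · funext k
    push_cast
    ring
  · simp only [add_apply, ContinuousLinearMap.comp_apply, inner_add_left,
      ContinuousLinearMap.adjoint_inner_left]
    rfl

lemma isSphericalIsometry_iff : W.IsSphericalIsometry ↔ ∀ k, W.α k ^ 2 + W.β k ^ 2 = 1 := by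
  constructor
  · intro h k
    -- Testing the operator identity on a basis vector isolates one diagonal entry.
    have h1 := W.hasSum_inner_T (lp.single 2 k (1 : ℂ)) (lp.single 2 k (1 : ℂ))
    rw [h] at h1
    have h2 := hasSum_single (f := fun j => ((W.α j ^ 2 + W.β j ^ 2 : ℝ) : ℂ) *
      inner ℂ ((lp.single 2 k (1 : ℂ) : lp (fun _ : ℕ × ℕ => ℂ) 2) j)
        ((lp.single 2 k (1 : ℂ) : lp (fun _ : ℕ × ℕ => ℂ) 2) j)) k
      (fun j hj => by simp [hj])
    have h3 := h1.unique h2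
    rw [ContinuousLinearMap.id_apply, inner_self_eq_norm_sq_to_K,
      lp.norm_single (by norm_num)] at h3
    simp only [norm_one, lp.single_apply_self, inner_self_eq_norm_sq_to_K] at h3
    norm_num at h3
    exact_mod_cast h3.symm
  · intro h
    refine ContinuousLinearMap.ext fun x => ext_inner_right ℂ fun y => ?_
    refine (W.hasSum_inner_T x y).unique ?_
    simp only [h, Complex.ofReal_one, one_mul]
    exact lp.hasSum_inner (𝕜 := ℂ) x y

lemma IsSphericalIsometry.moment_add (h : W.IsSphericalIsometry) (k : ℕ × ℕ) :
    W.moment (k + (1, 0)) + W.moment (k + (0, 1)) = W.moment k := by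
  rw [moment_add_fst, moment_add_snd, ← add_mul, isSphericalIsometry_iff.1 h, one_mul]

/-- A spherically isometric shift is determined by its `0`-th row. -/
lemma IsSphericalIsometry.eq_of_row (h : W.IsSphericalIsometry) (h' : W'.IsSphericalIsometry)
    (hrow : ∀ n, W.α (n, 0) = W'.α (n, 0)) : W = W' := by
  refine ext_of_moment ?_
  rintro ⟨m, n⟩
  induction n generalizing m with
  | zero => simp [moment, hrow]
  | succ n ih =>
    have h1 := h.moment_add (m, n)
    have h2 := h'.moment_add (m, n)
    simp only [Prod.mk_add_mk, add_zero] at h1 h2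
    linarith [ih m, ih (m + 1)]

end TwoVariableWeightedShift

/-! ### The spherically isometric shift over the Bergman shift -/

/-- The two-variable weighted shift with weights `α_k = √((k₁+1)/(k₁+k₂+2))` and
`β_k = √((k₂+1)/(k₁+k₂+2))`. -/
def bergmanSphericalShift : TwoVariableWeightedShift where
  α k := √(((k.1 : ℝ) + 1) / ((k.1 : ℝ) + k.2 + 2))
  β k := √(((k.2 : ℝ) + 1) / ((k.1 : ℝ) + k.2 + 2))
  α_pos k := by positivity
  β_pos k := by positivity
  α_bdd := ⟨1, fun k => by
    rw [abs_of_nonneg (Real.sqrt_nonneg _), Real.sqrt_le_one, div_le_one (by positivity)]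
    linarith [(Nat.cast_nonneg k.2 : (0 : ℝ) ≤ k.2)]⟩
  β_bdd := ⟨1, fun k => by
    rw [abs_of_nonneg (Real.sqrt_nonneg _), Real.sqrt_le_one, div_le_one (by positivity)]
    linarith [(Nat.cast_nonneg k.1 : (0 : ℝ) ≤ k.1)]⟩
  comm k := by
    rw [← Real.sqrt_mul (by positivity), ← Real.sqrt_mul (by positivity)]
    congr 1
    simp only [Prod.fst_add, Prod.snd_add, add_zero]
    push_cast
    field_simp
    ring

lemma bergmanSphericalShift_α_sq (k : ℕ × ℕ) :
    bergmanSphericalShift.α k ^ 2 = ((k.1 : ℝ) + 1) / ((k.1 : ℝ) + k.2 + 2) :=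
  Real.sq_sqrt (by positivity)

lemma bergmanSphericalShift_β_sq (k : ℕ × ℕ) :
    bergmanSphericalShift.β k ^ 2 = ((k.2 : ℝ) + 1) / ((k.1 : ℝ) + k.2 + 2) :=
  Real.sq_sqrt (by positivity)

lemma isSphericalIsometry_bergmanSphericalShift : bergmanSphericalShift.IsSphericalIsometry := by
  refine TwoVariableWeightedShift.isSphericalIsometry_iff.2 fun k => ?_
  rw [bergmanSphericalShift_α_sq, bergmanSphericalShift_β_sq]
  field_simp
  ring

lemma bergmanSphericalShift_row (n : ℕ) :
    bergmanSphericalShift.α (n, 0) = bergmanShift.weight n := by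
  simp [bergmanSphericalShift, bergmanShift]

lemma bergmanShift_moment (n : ℕ) : bergmanShift.moment n = 1 / ((n : ℝ) + 1) := by
  induction n with
  | zero => simp [UnilateralWeightedShift.moment]
  | succ n ih =>
    have h : bergmanShift.weight n ^ 2 = ((n : ℝ) + 1) / ((n : ℝ) + 2) :=
      Real.sq_sqrt (by positivity)
    rw [UnilateralWeightedShift.moment, Finset.prod_range_succ, ← UnilateralWeightedShift.moment,
      ih, h]
    push_cast
    field_simp
    ring

lemma bergmanSphericalShift_moment (m n : ℕ) :
    bergmanSphericalShift.moment (m, n) =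
      ((m.factorial : ℝ) * (n.factorial : ℝ)) / ((m + n + 1).factorial : ℝ) := by
  induction n with
  | zero =>
    induction m with
    | zero => simp [TwoVariableWeightedShift.moment]
    | succ m ih =>
      have h := bergmanSphericalShift.moment_add_fst (m, 0)
      simp only [Prod.mk_add_mk, add_zero] at h ih
      rw [h, ih, bergmanSphericalShift_α_sq, add_zero, Nat.factorial_succ (m + 1),
        Nat.factorial_succ m]
      push_cast
      field_simp
      ring
  | succ n ih =>
    have h := bergmanSphericalShift.moment_add_snd (m, n)
    simp only [Prod.mk_add_mk, add_zero] at h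
    rw [h, ih, bergmanSphericalShift_β_sq, ← add_assoc m n 1, Nat.factorial_succ (m + n + 1),
      Nat.factorial_succ n]
    push_cast
    field_simp
    ring

lemma tendsto_sqrt_succ_div_add_two :
    Filter.Tendsto (fun n : ℕ => √(((n : ℝ) + 1) / ((n : ℝ) + 2))) Filter.atTop (nhds 1) := by
  have h := tendsto_add_mul_div_add_mul_atTop_nhds (1 : ℝ) 2 1 one_ne_zero
  simp only [one_mul, div_one, add_comm (1 : ℝ), add_comm (2 : ℝ)] at h
  have h' := (Real.continuous_sqrt.tendsto 1).comp h
  rwa [Real.sqrt_one] at h'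

lemma norm_bergmanShift_op : ‖bergmanShift.op‖ = 1 := by
  refine norm_shiftOperator_eq_one _ _ _ _ (fun n => ?_) id tendsto_sqrt_succ_div_add_two
  change |√(((n : ℝ) + 1) / ((n : ℝ) + 2))| ≤ 1
  rw [abs_of_nonneg (Real.sqrt_nonneg _), Real.sqrt_le_one, div_le_one (by positivity)]
  linarith

lemma norm_bergmanSphericalShift_T₁ : ‖bergmanSphericalShift.T₁‖ = 1 := by
  refine norm_shiftOperator_eq_one _ _ _ _ (fun k => ?_) (fun n => (n, 0)) ?_
  · change |√(((k.1 : ℝ) + 1) / ((k.1 : ℝ) + k.2 + 2))| ≤ 1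
    rw [abs_of_nonneg (Real.sqrt_nonneg _), Real.sqrt_le_one, div_le_one (by positivity)]
    linarith [(Nat.cast_nonneg k.2 : (0 : ℝ) ≤ k.2)]
  · simpa [bergmanSphericalShift] using tendsto_sqrt_succ_div_add_two

lemma norm_bergmanSphericalShift_T₂ : ‖bergmanSphericalShift.T₂‖ = 1 := by
  refine norm_shiftOperator_eq_one _ _ _ _ (fun k => ?_) (fun n => (0, n)) ?_
  · change |√(((k.2 : ℝ) + 1) / ((k.1 : ℝ) + k.2 + 2))| ≤ 1
    rw [abs_of_nonneg (Real.sqrt_nonneg _), Real.sqrt_le_one, div_le_one (by positivity)]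
    linarith [(Nat.cast_nonneg k.1 : (0 : ℝ) ≤ k.1)]
  · simpa [bergmanSphericalShift] using tendsto_sqrt_succ_div_add_two

/-! ### Measures with prescribed moments -/

lemma integrable_of_continuous_of_ae_mem_Icc {σ : Measure ℝ} [IsFiniteMeasure σ]
    (hσ : σ (Icc 0 1)ᶜ = 0) {f : ℝ → ℝ} (hf : Continuous f) : Integrable f σ := by
  rw [← Measure.restrict_eq_self_of_ae_mem (s := Icc (0 : ℝ) 1) (μ := σ) (mem_ae_iff.2 hσ)]
  exact hf.continuousOn.integrableOn_compact isCompact_Icc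

/-- A measure on `[0,1]` with the moments of the Bergman shift has
`∫ r^m (1-r)^n dσ(r) = γ_{(m,n)}` for all `m` and `n`. -/
lemma integral_pow_mul_one_sub_pow {σ : Measure ℝ} [IsFiniteMeasure σ] (hσ : σ (Icc 0 1)ᶜ = 0)
    (hmom : ∀ n, bergmanShift.moment n = ∫ r, r ^ n ∂σ) (m n : ℕ) :
    ∫ r, r ^ m * (1 - r) ^ n ∂σ = bergmanSphericalShift.moment (m, n) := by
  induction n generalizing m with
  | zero =>
    simp only [pow_zero, mul_one, ← hmom]
    simp [UnilateralWeightedShift.moment, TwoVariableWeightedShift.moment,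
      bergmanSphericalShift_row]
  | succ n ih =>
    have h := isSphericalIsometry_bergmanSphericalShift.moment_add (m, n)
    simp only [Prod.mk_add_mk, add_zero] at h
    -- The moment at `(m, n+1)` is the one at `(m, n)` minus the one at `(m+1, n)`, just as `r^m
    -- (1-r)^(n+1) = r^m (1-r)^n - r^(m+1) (1-r)^n`.
    rw [← eq_sub_iff_add_eq', ← ih, ← ih, ← integral_sub
      (integrable_of_continuous_of_ae_mem_Icc hσ (by fun_prop))
      (integrable_of_continuous_of_ae_mem_Icc hσ (by fun_prop))] at h
    rw [h]
    congr 1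
    funext r
    ring

lemma isBergerMeasure_bergmanShift :
    bergmanShift.IsBergerMeasure (volume.restrict (Icc 0 1)) := by
  refine ⟨⟨by simp⟩, ?_, fun k => ?_⟩
  · rw [norm_bergmanShift_op, one_pow, Measure.restrict_apply measurableSet_Icc.compl,
      compl_inter_self, measure_empty]
  · rw [bergmanShift_moment, integral_Icc_eq_integral_Ioc,
      ← intervalIntegral.integral_of_le zero_le_one, integral_pow]
    simp

/-- Uniqueness of the Berger measure of the Bergman shift is not needed: any such measure on `[0,1]`
yields the same mixed moments. -/
lemma isSphericallyIsometricEmbedding_bergmanShift_iff (W : TwoVariableWeightedShift) :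
    IsSphericallyIsometricEmbedding bergmanShift W ↔ W = bergmanSphericalShift := by
  constructor
  · rintro ⟨-, -, -, σ, hσ, hcar, hmom⟩
    have := hσ.1
    refine TwoVariableWeightedShift.ext_of_moment ?_
    rintro ⟨m, n⟩
    rw [hmom, Measure.restrict_eq_self_of_ae_mem (s := Icc (0 : ℝ) 1) (mem_ae_iff.2 hcar),
      ← integral_pow_mul_one_sub_pow hcar hσ.2.2]
    simp
  · rintro rfl
    have hcar : (volume.restrict (Icc (0 : ℝ) 1)) (Icc 0 1)ᶜ = 0 := by
      rw [Measure.restrict_apply measurableSet_Icc.compl, compl_inter_self, measure_empty]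
    refine ⟨le_rfl, fun r hr => ?_, fun r _ s _ h => ?_, volume.restrict (Icc 0 1),
      isBergerMeasure_bergmanShift, hcar, ?_⟩
    · simpa using hr
    · simpa using congrArg Prod.fst h
    · rintro ⟨m, n⟩
      rw [Measure.restrict_eq_self_of_ae_mem (s := Icc (0 : ℝ) 1) (mem_ae_iff.2 hcar),
        ← integral_pow_mul_one_sub_pow hcar isBergerMeasure_bergmanShift.2.2]
      simp

/-- Two finite measures on the plane which are carried by the same compact set and have the same
moments are equal. -/
lemma ext_of_moments_of_isCompact {μ ν : Measure (EuclideanSpace ℝ (Fin 2))} [IsFiniteMeasure μ]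
    [IsFiniteMeasure ν] {K : Set (EuclideanSpace ℝ (Fin 2))} (hK : IsCompact K) (hμ : μ Kᶜ = 0)
    (hν : ν Kᶜ = 0)
    (h : ∀ k : ℕ × ℕ, ∫ x, x 0 ^ k.1 * x 1 ^ k.2 ∂μ = ∫ x, x 0 ^ k.1 * x 1 ^ k.2 ∂ν) :
    μ = ν := by
  have : CompactSpace K := isCompact_iff_compactSpace.1 hK
  have hKm : MeasurableSet K := hK.measurableSet
  have hemb := MeasurableEmbedding.subtype_coe hKm
  have hcomap : ∀ ρ : Measure (EuclideanSpace ℝ (Fin 2)), ρ Kᶜ = 0 →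
      (ρ.comap ((↑) : K → EuclideanSpace ℝ (Fin 2))).map (↑) = ρ := fun ρ hρ => by
    rw [hemb.map_comap, Subtype.range_coe, Measure.restrict_eq_self_of_ae_mem (mem_ae_iff.2 hρ)]
  have hfin : ∀ ρ : Measure (EuclideanSpace ℝ (Fin 2)), IsFiniteMeasure ρ →
      IsFiniteMeasure (ρ.comap ((↑) : K → EuclideanSpace ℝ (Fin 2))) := fun ρ _ =>
    ⟨by rw [hemb.comap_apply]; exact measure_lt_top _ _⟩
  have := hfin μ inferInstance
  have := hfin ν inferInstance
  let c : Fin 2 → BoundedContinuousFunction K ℝ := fun i =>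
    BoundedContinuousFunction.mkOfCompact ⟨fun x => (x : EuclideanSpace ℝ (Fin 2)) i, by fun_prop⟩
  -- The polynomial functions on `K`. They separate points because the coordinates do, so equality
  -- of integrals over them forces equality of the measures.
  let A : StarSubalgebra ℝ (BoundedContinuousFunction K ℝ) :=
    { (MvPolynomial.aeval (R := ℝ) c).range with
      star_mem' := fun {a} ha => by
        have : star a = a := by ext; simp
        rwa [this] }
  suffices hc : μ.comap ((↑) : K → EuclideanSpace ℝ (Fin 2)) = ν.comap (↑) by
    rw [← hcomap μ hμ, ← hcomap ν hν, hc]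
  refine ext_of_forall_mem_subalgebra_integral_eq_of_pseudoEMetric_complete_countable
    (𝕜 := ℝ) (A := A) ?_ ?_
  · intro x y hxy
    obtain ⟨i, hi⟩ : ∃ i, (x : EuclideanSpace ℝ (Fin 2)) i ≠ (y : EuclideanSpace ℝ (Fin 2)) i := by
      by_contra! hcon
      exact hxy (Subtype.ext (PiLp.ext hcon))
    exact ⟨c i, ⟨c i, ⟨c i, ⟨MvPolynomial.X i, MvPolynomial.aeval_X _ _⟩, rfl⟩, rfl⟩, hi⟩
  · rintro _ ⟨p, rfl⟩
    have hint : ∀ (ρ : Measure K) [IsFiniteMeasure ρ] (q : MvPolynomial (Fin 2) ℝ),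
        Integrable (fun x => MvPolynomial.aeval c q x) ρ := fun ρ _ q =>
      BoundedContinuousFunction.integrable ρ _
    change ∫ x, MvPolynomial.aeval c p x ∂_ = ∫ x, MvPolynomial.aeval c p x ∂_
    induction p using MvPolynomial.induction_on' with
    | monomial u a =>
      have hmon : ∀ x : K, MvPolynomial.aeval c (MvPolynomial.monomial u a) x =
          a * ((x : EuclideanSpace ℝ (Fin 2)) 0 ^ u 0 *
            (x : EuclideanSpace ℝ (Fin 2)) 1 ^ u 1) := fun x => by
        rw [MvPolynomial.aeval_monomial, Finsupp.prod_fintype _ _ (by simp), Fin.prod_univ_two]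
        rfl
      simp only [hmon]
      have hρ : ∀ ρ : Measure (EuclideanSpace ℝ (Fin 2)), ρ Kᶜ = 0 →
          ∫ x : K, a * ((x : EuclideanSpace ℝ (Fin 2)) 0 ^ u 0 *
            (x : EuclideanSpace ℝ (Fin 2)) 1 ^ u 1) ∂(ρ.comap (↑)) =
          a * ∫ x, x 0 ^ u 0 * x 1 ^ u 1 ∂ρ := fun ρ h0 => by
        rw [integral_const_mul, ← hemb.integral_map
          (fun x : EuclideanSpace ℝ (Fin 2) => x 0 ^ u 0 * x 1 ^ u 1), hcomap ρ h0]
      rw [hρ μ hμ, hρ ν hν, h (u 0, u 1)]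
    | add p q hp hq =>
      simp only [map_add, BoundedContinuousFunction.add_apply]
      rw [integral_add (hint _ p) (hint _ q), integral_add (hint _ p) (hint _ q), hp, hq]

/-! ### Arclength on the unit segment -/

lemma unitSegment_param_eq_lineMap (r : ℝ) :
    (!₂[r, 1 - r] : EuclideanSpace ℝ (Fin 2)) = AffineMap.lineMap !₂[0, 1] !₂[1, 0] r := by
  ext i
  fin_cases i <;> simp [AffineMap.lineMap_apply, sub_eq_neg_add]

lemma continuous_unitSegment_param :
    Continuous fun r : ℝ => (!₂[r, 1 - r] : EuclideanSpace ℝ (Fin 2)) := by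
  fun_prop

/-- Normalized arclength on the unit segment is the image of Lebesgue measure on `[0,1]`. -/
lemma normalizedArclength_unitSegment :
    normalizedArclength unitSegment =
      (volume.restrict (Icc (0 : ℝ) 1)).map fun r => !₂[r, 1 - r] := by
  -- The parametrization is affine, so it scales one-dimensional measure by the distance between the
  -- endpoints; normalization cancels this factor.
  have hH : ∀ s : Set ℝ, μH[1] ((fun r : ℝ => (!₂[r, 1 - r] : EuclideanSpace ℝ (Fin 2))) '' s) =
      (nndist (!₂[0, 1] : EuclideanSpace ℝ (Fin 2)) !₂[1, 0] : ℝ≥0∞) * volume s := fun s => by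
    simp only [unitSegment_param_eq_lineMap]
    rw [hausdorffMeasure_lineMap_image, hausdorffMeasure_real]
    rfl
  have hne : (nndist (!₂[0, 1] : EuclideanSpace ℝ (Fin 2)) !₂[1, 0] : ℝ≥0∞) ≠ 0 := by
    rw [ENNReal.coe_ne_zero, Ne, nndist_eq_zero]
    intro h
    simpa using congrArg (fun x : EuclideanSpace ℝ (Fin 2) => x 0) h
  have hL : μH[1] unitSegment =
      (nndist (!₂[0, 1] : EuclideanSpace ℝ (Fin 2)) !₂[1, 0] : ℝ≥0∞) := by
    rw [unitSegment, hH]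
    simp
  ext A hA
  rw [normalizedArclength, Measure.smul_apply, Measure.restrict_apply hA,
    Measure.map_apply continuous_unitSegment_param.measurable hA,
    Measure.restrict_apply (continuous_unitSegment_param.measurable hA), hL, unitSegment,
    ← image_preimage_inter, hH, smul_eq_mul, ← mul_assoc,
    ENNReal.inv_mul_cancel hne ENNReal.coe_ne_top, one_mul]

lemma isBergerMeasure_normalizedArclength :
    bergmanSphericalShift.IsBergerMeasure (normalizedArclength unitSegment) := by
  rw [normalizedArclength_unitSegment]
  have hb := isBergerMeasure_bergmanShift
  have hm := continuous_unitSegment_param.measurable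
  have := hb.1
  have hcar : (volume.restrict (Icc (0 : ℝ) 1)) (Icc 0 1)ᶜ = 0 := by
    simp
  refine ⟨Measure.isProbabilityMeasure_map hm.aemeasurable, ?_, ?_⟩
  · rw [← mem_ae_iff, mem_ae_map_iff hm.aemeasurable, norm_bergmanSphericalShift_T₁,
      norm_bergmanSphericalShift_T₂]
    · filter_upwards [mem_ae_iff.2 hcar] with r hr
      simpa [and_comm] using hr
    · measurability
  · rintro ⟨m, n⟩
    rw [integral_map hm.aemeasurable (Continuous.aestronglyMeasurable (by fun_prop)),
      ← integral_pow_mul_one_sub_pow hcar hb.2.2]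
    simp

lemma isBergerMeasure_bergmanSphericalShift_iff (μ : Measure (EuclideanSpace ℝ (Fin 2))) :
    bergmanSphericalShift.IsBergerMeasure μ ↔ μ = normalizedArclength unitSegment := by
  constructor
  · intro hμ
    have hν := isBergerMeasure_normalizedArclength
    have := hμ.1
    have := hν.1
    refine ext_of_moments_of_isCompact (K := {x | x 0 ∈ Icc 0 (‖bergmanSphericalShift.T₁‖ ^ 2) ∧
      x 1 ∈ Icc 0 (‖bergmanSphericalShift.T₂‖ ^ 2)}) ?_ hμ.2.1 hν.2.1
      fun k => by rw [← hμ.2.2, ← hν.2.2]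
    rw [norm_bergmanSphericalShift_T₁, norm_bergmanSphericalShift_T₂]
    -- The rectangle is the image of a product of compact intervals.
    have h := (isCompact_univ_pi fun _ : Fin 2 => isCompact_Icc (a := (0 : ℝ)) (b := 1 ^ 2)).image
      (PiLp.continuous_toLp 2 fun _ : Fin 2 => ℝ)
    convert h using 1
    ext x
    constructor
    · intro hx
      refine ⟨x.ofLp, fun i _ => ?_, rfl⟩
      fin_cases i
      exacts [hx.1, hx.2]
    · rintro ⟨y, hy, rfl⟩
      exact ⟨hy 0 (mem_univ _), hy 1 (mem_univ _)⟩
  · rintro rfl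
    exact isBergerMeasure_normalizedArclength

open scoped ComplexConjugate

/-! ### Moments of the surface measure of the sphere -/

/-- The angle `π / (a - b)` makes the expression equal to `-1`. -/
lemma exists_unit_pow_mul_conj_pow_ne_one {a b : ℕ} (hab : a ≠ b) :
    ∃ c : Circle, (c : ℂ) ^ a * conj (c : ℂ) ^ b ≠ 1 := by
  have hd : ((a : ℝ) - b) ≠ 0 := sub_ne_zero.2 (Nat.cast_injective.ne hab)
  refine ⟨Circle.exp (Real.pi / ((a : ℝ) - b)), fun h => ?_⟩
  have h1 : ((Circle.exp (Real.pi / ((a : ℝ) - b)) : Circle) : ℂ) ^ a *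
      conj ((Circle.exp (Real.pi / ((a : ℝ) - b)) : Circle) : ℂ) ^ b = -1 := by
    rw [Circle.coe_exp, ← Complex.exp_conj, ← Complex.exp_nat_mul, ← Complex.exp_nat_mul,
      ← Complex.exp_add, ← Complex.exp_pi_mul_I]
    congr 1
    have hd' : ((a : ℂ) - b) ≠ 0 := by exact_mod_cast hd
    simp only [map_mul, Complex.conj_I, Complex.conj_ofReal]
    push_cast
    field_simp
    ring
  rw [h] at h1
  norm_num at h1

lemma integral_pow_mul_conj_pow_mul_exp_neg_sq (a b : ℕ) :
    ∫ z : ℂ, z ^ a * conj z ^ b * Real.exp (-‖z‖ ^ 2) =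
      if a = b then (Real.pi : ℂ) * a.factorial else 0 := by
  split_ifs with hab
  · subst hab
    have h := Complex.integral_rpow_mul_exp_neg_rpow (p := 2) (q := 2 * a) (by norm_num)
      (by have := (Nat.cast_nonneg a : (0 : ℝ) ≤ a); linarith)
    have h2 : ((2 * a + 2 : ℝ) / 2) = a + 1 := by ring
    rw [h2, Real.Gamma_nat_eq_factorial, mul_div_cancel_left₀ _ (two_ne_zero)] at h
    have h3 : ∀ z : ℂ, z ^ a * conj z ^ a * Real.exp (-‖z‖ ^ 2) =
        ((‖z‖ ^ (2 * a : ℝ) * Real.exp (-‖z‖ ^ (2 : ℝ)) : ℝ) : ℂ) := fun z => by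
      rw [← mul_pow, Complex.mul_conj, Complex.normSq_eq_norm_sq, Real.rpow_mul (norm_nonneg _),
        Real.rpow_natCast, Real.rpow_two]
      push_cast
      rfl
    simp only [h3]
    rw [integral_complex_ofReal, h]
    push_cast
    rfl
  -- Rotation by `c` preserves Lebesgue measure but multiplies the integrand by a constant other
  -- than `1`, so the integral vanishes.
  · obtain ⟨c, hc⟩ := exists_unit_pow_mul_conj_pow_ne_one hab
    have h := (LinearIsometryEquiv.measurePreserving (rotation c)).integral_comp
      (rotation c).toHomeomorph.measurableEmbedding
      (fun z : ℂ => z ^ a * conj z ^ b * Real.exp (-‖z‖ ^ 2))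
    have h2 : ∀ z : ℂ, (rotation c z) ^ a * conj (rotation c z) ^ b *
        Real.exp (-‖rotation c z‖ ^ 2) = ((c : ℂ) ^ a * conj (c : ℂ) ^ b) *
          (z ^ a * conj z ^ b * Real.exp (-‖z‖ ^ 2)) := fun z => by
      rw [LinearIsometryEquiv.norm_map, rotation_apply, map_mul]
      ring
    simp only [h2] at h
    rw [integral_const_mul] at h
    have h3 : ((c : ℂ) ^ a * conj (c : ℂ) ^ b - 1) *
        (∫ z : ℂ, z ^ a * conj z ^ b * Real.exp (-‖z‖ ^ 2)) = 0 := by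
      rw [sub_mul, h, one_mul, sub_self]
    exact (mul_eq_zero.1 h3).resolve_left (sub_ne_zero.2 hc)

/-- The volume of `ℂ²` is a multiple of the product measure. -/
lemma exists_integral_eq_const_mul_integral_pi :
    ∃ c : ℂ, ∀ f : EuclideanSpace ℂ (Fin 2) → ℂ,
      ∫ z, f z = c * ∫ x : Fin 2 → ℂ, f (WithLp.toLp 2 x) := by
  let e : (Fin 2 → ℂ) ≃L[ℝ] EuclideanSpace ℂ (Fin 2) :=
    (PiLp.continuousLinearEquiv 2 ℝ fun _ : Fin 2 => ℂ).symm
  have he : ((volume : Measure (Fin 2 → ℂ)).map e).IsAddHaarMeasure :=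
    e.isAddHaarMeasure_map volume
  -- Uniqueness of Haar measure provides the factor; its value is irrelevant, as normalization
  -- removes it later.
  refine ⟨((volume : Measure (EuclideanSpace ℂ (Fin 2))).addHaarScalarFactor
    ((volume : Measure (Fin 2 → ℂ)).map e) : ℝ), fun f => ?_⟩
  conv_lhs => rw [Measure.isAddLeftInvariant_eq_smul (volume : Measure (EuclideanSpace ℂ (Fin 2)))
    ((volume : Measure (Fin 2 → ℂ)).map e)]
  have hemb : MeasurableEmbedding e := e.toHomeomorph.measurableEmbedding
  rw [integral_smul_nnreal_measure, hemb.integral_map, NNReal.smul_def, Complex.real_smul]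
  rfl

/-- Integration in polar coordinates of a homogeneous function times a Gaussian. -/
lemma integral_homogeneous_mul_exp_neg_sq {E : Type*} [NormedAddCommGroup E]
    [NormedSpace ℝ E] [FiniteDimensional ℝ E] [Nontrivial E] [MeasurableSpace E] [BorelSpace E]
    (μ : Measure E) [μ.IsAddHaarMeasure] (g : E → ℂ) (d : ℕ)
    (hg : ∀ r : ℝ, 0 < r → ∀ x, g (r • x) = (r : ℂ) ^ d * g x) :
    ∫ x, g x * Real.exp (-‖x‖ ^ 2) ∂μ = (∫ u : Metric.sphere (0 : E) 1, g u ∂μ.toSphere) *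
      (Real.Gamma (((d : ℝ) + Module.finrank ℝ E) / 2) / 2 : ℝ) := by
  have hn : 0 < Module.finrank ℝ E := Module.finrank_pos
  calc
    ∫ x, g x * Real.exp (-‖x‖ ^ 2) ∂μ
        = ∫ x : ({(0)}ᶜ : Set E), g x * Real.exp (-‖(x : E)‖ ^ 2) ∂(μ.comap (↑)) := by
      rw [integral_subtype_comap (measurableSet_singleton _).compl
        fun x => g x * Real.exp (-‖x‖ ^ 2), restrict_compl_singleton]
    _ = ∫ x : Metric.sphere (0 : E) 1 × Ioi (0 : ℝ),
          g x.1 * (((x.2 : ℝ) ^ d * Real.exp (-(x.2 : ℝ) ^ 2) : ℝ) : ℂ)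
            ∂μ.toSphere.prod (.volumeIoiPow (Module.finrank ℝ E - 1)) := by
      rw [← μ.measurePreserving_homeomorphUnitSphereProd.integral_comp
        (Homeomorph.measurableEmbedding _)]
      refine integral_congr_ae (Filter.Eventually.of_forall fun x => ?_)
      have hx : 0 < ‖(x : E)‖ := norm_pos_iff.2 x.2
      -- Homogeneity applied at the unit vector `x / ‖x‖` splits the integrand into an angular and a
      -- radial factor.
      have h := hg ‖(x : E)‖ hx (‖(x : E)‖⁻¹ • (x : E))
      rw [smul_inv_smul₀ hx.ne'] at h
      simp only [homeomorphUnitSphereProd_apply_fst_coe, homeomorphUnitSphereProd_apply_snd_coe]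
      rw [h]
      push_cast
      ring
    _ = (∫ u : Metric.sphere (0 : E) 1, g u ∂μ.toSphere) *
          ∫ r : Ioi (0 : ℝ), (((r : ℝ) ^ d * Real.exp (-(r : ℝ) ^ 2) : ℝ) : ℂ)
            ∂.volumeIoiPow (Module.finrank ℝ E - 1) :=
      integral_prod_mul (fun u : Metric.sphere (0 : E) 1 => g u)
        fun r : Ioi (0 : ℝ) => (((r : ℝ) ^ d * Real.exp (-(r : ℝ) ^ 2) : ℝ) : ℂ)
    _ = _ := by
      congr 1
      rw [integral_complex_ofReal]
      congr 1
      simp only [Measure.volumeIoiPow, ENNReal.ofReal]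
      rw [integral_withDensity_eq_integral_smul
          (measurable_subtype_coe.pow_const _).real_toNNReal,
        integral_subtype_comap measurableSet_Ioi fun a : ℝ =>
          Real.toNNReal (a ^ (Module.finrank ℝ E - 1)) • (a ^ d * Real.exp (-a ^ 2))]
      -- The exponent combines the degree `d` with the polar Jacobian `r^(finrank - 1)`.
      have h := integral_rpow_mul_exp_neg_rpow (p := 2) (q := d + Module.finrank ℝ E - 1)
        (by norm_num) (by
          have : (0 : ℝ) < Module.finrank ℝ E := Nat.cast_pos.2 hn
          have := (Nat.cast_nonneg d : (0 : ℝ) ≤ d)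
          linarith)
      rw [sub_add_cancel] at h
      rw [div_eq_inv_mul (Real.Gamma _), ← one_div, ← h]
      refine setIntegral_congr_fun measurableSet_Ioi fun r hr => ?_
      have hr' : (0 : ℝ) < r := hr
      simp only [NNReal.smul_def, Real.coe_toNNReal _ (pow_nonneg hr'.le _), smul_eq_mul,
        Real.rpow_two]
      rw [← mul_assoc, ← pow_add, ← Real.rpow_natCast]
      congr 2
      rw [Nat.cast_add, Nat.cast_sub hn]
      push_cast
      ring

instance : IsProbabilityMeasure surfaceMeasure := by
  refine ⟨?_⟩
  rw [surfaceMeasure, Measure.smul_apply, smul_eq_mul]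
  exact ENNReal.inv_mul_cancel (Measure.measure_univ_ne_zero.2 (Measure.toSphere_ne_zero _))
    (measure_ne_top _ _)

lemma finrank_real_complex_plane : Module.finrank ℝ (EuclideanSpace ℂ (Fin 2)) = 4 := by
  rw [← Module.finrank_mul_finrank ℝ ℂ (EuclideanSpace ℂ (Fin 2))]
  simp

/-- The mixed moments of the surface measure, up to a common factor. -/
lemma exists_integral_sphere_mul_Gamma :
    ∃ C : ℂ, ∀ a b : Fin 2 → ℕ,
      (∫ z : Sphere, ∏ i, ((z : EuclideanSpace ℂ (Fin 2)) i ^ a i *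
        conj ((z : EuclideanSpace ℂ (Fin 2)) i) ^ b i) ∂surfaceMeasure) *
          (Real.Gamma ((((∑ i, (a i + b i) : ℕ) : ℝ) + 4) / 2) : ℝ) =
        C * ∏ i, if a i = b i then (Real.pi : ℂ) * (a i).factorial else 0 := by
  obtain ⟨c, hc⟩ := exists_integral_eq_const_mul_integral_pi
  set M : ℝ := ((volume : Measure (EuclideanSpace ℂ (Fin 2))).toSphere univ)⁻¹.toReal
  refine ⟨2 * M * c, fun a b => ?_⟩
  have h := integral_homogeneous_mul_exp_neg_sq (volume : Measure (EuclideanSpace ℂ (Fin 2)))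
    (fun z => ∏ i, (z i ^ a i * conj (z i) ^ b i)) (∑ i, (a i + b i)) (fun r _ x => by
      rw [← Finset.prod_pow_eq_pow_sum, ← Finset.prod_mul_distrib]
      refine Finset.prod_congr rfl fun i _ => ?_
      rw [PiLp.smul_apply, Complex.real_smul, map_mul, Complex.conj_ofReal]
      ring)
  rw [hc, finrank_real_complex_plane] at h
  have h2 : ∀ x : Fin 2 → ℂ, (∏ i, ((WithLp.toLp 2 x : EuclideanSpace ℂ (Fin 2)) i ^ a i *
      conj ((WithLp.toLp 2 x : EuclideanSpace ℂ (Fin 2)) i) ^ b i)) *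
        (Real.exp (-‖(WithLp.toLp 2 x : EuclideanSpace ℂ (Fin 2))‖ ^ 2) : ℝ) =
      ∏ i, (x i ^ a i * conj (x i) ^ b i * (Real.exp (-‖x i‖ ^ 2) : ℝ)) := fun x => by
    rw [EuclideanSpace.norm_sq_eq, Finset.prod_mul_distrib (f := fun i => x i ^ a i * _),
      ← Finset.sum_neg_distrib, Real.exp_sum]
    push_cast
    rfl
  simp only [h2] at h
  rw [integral_fintype_prod_volume_eq_prod
    (f := fun i (z : ℂ) => z ^ a i * conj z ^ b i * (Real.exp (-‖z‖ ^ 2) : ℝ))] at h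
  simp only [integral_pow_mul_conj_pow_mul_exp_neg_sq] at h
  rw [surfaceMeasure, integral_smul_measure, mul_assoc (2 * (M : ℂ)), h, Complex.real_smul]
  push_cast
  ring

/-- The mixed moments of the normalized surface measure on the unit sphere of `ℂ²`. -/
lemma integral_sphere_monomial (a b : Fin 2 → ℕ) :
    ∫ z : Sphere, ∏ i, ((z : EuclideanSpace ℂ (Fin 2)) i ^ a i *
        conj ((z : EuclideanSpace ℂ (Fin 2)) i) ^ b i) ∂surfaceMeasure =
      if a = b then ((a 0).factorial * (a 1).factorial / (a 0 + a 1 + 1).factorial : ℂ) else 0 := by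
  obtain ⟨C, hC⟩ := exists_integral_sphere_mul_Gamma
  -- The case of the constant function `1`, of integral `1`, gives `C π² = 1`.
  have h0 := hC 0 0
  have hG2 : Real.Gamma (4 / 2) = 1 := by norm_num
  simp [hG2] at h0
  have h := hC a b
  split_ifs with hab
  · subst hab
    have hG : ((((∑ i, (a i + a i) : ℕ) : ℝ) + 4) / 2) = ((a 0 + a 1 + 1 : ℕ) : ℝ) + 1 := by
      rw [Fin.sum_univ_two]
      push_cast
      ring
    rw [hG, Real.Gamma_nat_eq_factorial] at h
    simp only [if_true] at h
    rw [Fin.prod_univ_two (fun i => (Real.pi : ℂ) * (a i).factorial)] at h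
    have hf : ((a 0 + a 1 + 1).factorial : ℂ) ≠ 0 := Nat.cast_ne_zero.2 (Nat.factorial_ne_zero _)
    rw [eq_div_iff hf]
    push_cast at h
    rw [h]
    linear_combination -((a 0).factorial * (a 1).factorial : ℂ) * h0
  · have hz : ∏ i, (if a i = b i then (Real.pi : ℂ) * (a i).factorial else 0) = 0 := by
      obtain ⟨i, hi⟩ := Function.ne_iff.1 hab
      exact Finset.prod_eq_zero (Finset.mem_univ i) (if_neg hi)
    rw [hz, mul_zero] at h
    refine (mul_eq_zero.1 h).resolve_right ?_
    exact_mod_cast (Real.Gamma_pos_of_pos (by positivity)).ne'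

/-! ### The monomial basis of the Hardy space -/

/-- The monomial `z₁^{k₁} z₂^{k₂}`. -/
def monomialPoly (k : ℕ × ℕ) : MvPolynomial (Fin 2) ℂ :=
  MvPolynomial.X 0 ^ k.1 * MvPolynomial.X 1 ^ k.2

lemma inner_polyToL2_monomialPoly (k l : ℕ × ℕ) :
    inner ℂ (polyToL2 (monomialPoly k)) (polyToL2 (monomialPoly l)) =
      if k = l then (bergmanSphericalShift.moment k : ℂ) else 0 := by
  have hae : ∀ j : ℕ × ℕ, polyToL2 (monomialPoly j) =ᵐ[surfaceMeasure]
      fun z => (z : EuclideanSpace ℂ (Fin 2)) 0 ^ j.1 *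
        (z : EuclideanSpace ℂ (Fin 2)) 1 ^ j.2 := fun j => by
    filter_upwards [ContinuousMap.coeFn_toLp (p := 2) (𝕜 := ℂ) surfaceMeasure
      (MvPolynomial.aeval coord (monomialPoly j))] with z hz
    change (ContinuousMap.toLp (E := ℂ) 2 surfaceMeasure ℂ
      (MvPolynomial.aeval coord (monomialPoly j)) : Sphere → ℂ) z = _
    rw [hz]
    simp [monomialPoly, coord]
  -- The indices are swapped because the inner product conjugates its first argument.
  have h := integral_sphere_monomial ![l.1, l.2] ![k.1, k.2]
  rw [L2.inner_def]
  trans ∫ z : Sphere, ∏ i, ((z : EuclideanSpace ℂ (Fin 2)) i ^ (![l.1, l.2] : Fin 2 → ℕ) i *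
        conj ((z : EuclideanSpace ℂ (Fin 2)) i) ^ (![k.1, k.2] : Fin 2 → ℕ) i) ∂surfaceMeasure
  · refine integral_congr_ae ?_
    filter_upwards [hae k, hae l] with z hk hl
    rw [hk, hl, RCLike.inner_apply, Fin.prod_univ_two]
    simp only [map_mul, map_pow, Matrix.cons_val_zero, Matrix.cons_val_one]
    ring
  · rw [h]
    by_cases hkl : k = l
    · subst hkl
      obtain ⟨m, n⟩ := k
      rw [if_pos rfl, if_pos rfl, bergmanSphericalShift_moment]
      simp
    · rw [if_neg hkl, if_neg]
      intro h'
      exact hkl (Prod.ext (congrFun h' 0).symm (congrFun h' 1).symm)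

lemma polyToL2_mem_hardySpace (p : MvPolynomial (Fin 2) ℂ) : polyToL2 p ∈ hardySpace :=
  Submodule.le_topologicalClosure _ ⟨p, rfl⟩

/-- The normalized monomials in the Hardy space. -/
def monomialVector (k : ℕ × ℕ) : hardySpace :=
  ((√(bergmanSphericalShift.moment k) : ℝ) : ℂ)⁻¹ •
    ⟨polyToL2 (monomialPoly k), polyToL2_mem_hardySpace _⟩

lemma coe_monomialVector (k : ℕ × ℕ) :
    (monomialVector k : Lp ℂ 2 surfaceMeasure) =
      ((√(bergmanSphericalShift.moment k) : ℝ) : ℂ)⁻¹ • polyToL2 (monomialPoly k) := rfl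

lemma sqrt_moment_ne_zero (k : ℕ × ℕ) :
    ((√(bergmanSphericalShift.moment k) : ℝ) : ℂ) ≠ 0 :=
  Complex.ofReal_ne_zero.2 (Real.sqrt_pos.2 (bergmanSphericalShift.moment_pos k)).ne'

lemma orthonormal_monomialVector : Orthonormal ℂ monomialVector := by
  rw [orthonormal_iff_ite]
  intro k l
  rw [Submodule.coe_inner, coe_monomialVector, coe_monomialVector, inner_smul_left,
    inner_smul_right, inner_polyToL2_monomialPoly]
  split_ifs with h
  · subst h
    have h1 : ((bergmanSphericalShift.moment k : ℝ) : ℂ) =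
        ((√(bergmanSphericalShift.moment k) : ℝ) : ℂ) *
          ((√(bergmanSphericalShift.moment k) : ℝ) : ℂ) := by
      rw [← Complex.ofReal_mul, Real.mul_self_sqrt (bergmanSphericalShift.moment_pos k).le]
    rw [map_inv₀, Complex.conj_ofReal, ← mul_assoc, ← mul_inv, ← h1, inv_mul_cancel₀
      (Complex.ofReal_ne_zero.2 (bergmanSphericalShift.moment_pos k).ne')]
  · simp

lemma polyToL2_mem_span_monomialVector (p : MvPolynomial (Fin 2) ℂ) :
    (⟨polyToL2 p, polyToL2_mem_hardySpace p⟩ : hardySpace) ∈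
      Submodule.span ℂ (range monomialVector) := by
  induction p using MvPolynomial.induction_on' with
  | monomial u a =>
    have h : (⟨polyToL2 (MvPolynomial.monomial u a), polyToL2_mem_hardySpace _⟩ : hardySpace) =
        (a * ((√(bergmanSphericalShift.moment (u 0, u 1)) : ℝ) : ℂ)) •
          monomialVector (u 0, u 1) := by
      refine Subtype.ext ?_
      rw [Submodule.coe_smul, coe_monomialVector, smul_smul, mul_assoc,
        mul_inv_cancel₀ (sqrt_moment_ne_zero _), mul_one, ← map_smul, MvPolynomial.monomial_eq,
        Finsupp.prod_fintype _ _ (by simp), Fin.prod_univ_two, MvPolynomial.smul_eq_C_mul]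
      rfl
    rw [h]
    exact Submodule.smul_mem _ _ (Submodule.subset_span (mem_range_self _))
  | add p q hp hq =>
    convert Submodule.add_mem _ hp hq using 1
    exact Subtype.ext (map_add polyToL2 p q)

instance : CompleteSpace hardySpace :=
  inferInstanceAs (CompleteSpace (LinearMap.range polyToL2).topologicalClosure)

/-- The normalized monomials form an orthonormal basis of the Hardy space. -/
def monomialBasis : HilbertBasis (ℕ × ℕ) ℂ hardySpace :=
  HilbertBasis.mk orthonormal_monomialVector (by
    intro f _
    change f ∈ closure (Submodule.span ℂ (range monomialVector) : Set hardySpace)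
    rw [closure_subtype]
    refine closure_mono ?_ f.2
    rintro _ ⟨p, rfl⟩
    exact ⟨_, polyToL2_mem_span_monomialVector p, rfl⟩)

lemma monomialBasis_apply (k : ℕ × ℕ) : monomialBasis k = monomialVector k := by
  simp [monomialBasis]

/-! ### The unitary equivalence -/

/-- Multiplication by `z_i` only shifts the exponent; the factor `a` comes from the change of
normalization from `√γ_k` to `√γ_l = a √γ_k`. -/
lemma mulCoord_monomialVector {i : Fin 2} {k l : ℕ × ℕ} {a : ℝ} (ha : 0 ≤ a)
    (hX : MvPolynomial.X i * monomialPoly k = monomialPoly l)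
    (hmom : bergmanSphericalShift.moment l = a ^ 2 * bergmanSphericalShift.moment k) :
    mulCoord i (monomialVector k) = (a : ℂ) • monomialVector l := by
  refine Subtype.ext ?_
  change mulCoordL2 i (monomialVector k : Lp ℂ 2 surfaceMeasure) =
    (a : ℂ) • (monomialVector l : Lp ℂ 2 surfaceMeasure)
  have hl := sqrt_moment_ne_zero l
  have hs : ((√(bergmanSphericalShift.moment l) : ℝ) : ℂ) =
      a * ((√(bergmanSphericalShift.moment k) : ℝ) : ℂ) := by
    rw [hmom, Real.sqrt_mul (sq_nonneg a), Real.sqrt_sq ha, Complex.ofReal_mul]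
  rw [coe_monomialVector, coe_monomialVector, map_smul, mulCoordL2_polyToL2, hX, smul_smul]
  congr 1
  rw [hs] at hl ⊢
  rw [mul_inv, mul_inv_cancel_left₀ (left_ne_zero_of_mul hl)]

/-- Both sides are continuous and linear in `x`, so agreement on the standard basis vectors is
enough. -/
lemma repr_symm_shiftOperator {s : ℕ × ℕ → ℕ × ℕ} (hs : Function.Injective s) {w : ℕ × ℕ → ℝ}
    (hw : ∃ C : ℝ, ∀ i, |w i| ≤ C) {B : hardySpace →L[ℂ] hardySpace}
    (hB : ∀ k, B (monomialVector k) = (w k : ℂ) • monomialVector (s k))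
    (x : lp (fun _ : ℕ × ℕ => ℂ) 2) :
    monomialBasis.repr.symm (shiftOperator s hs w hw x) = B (monomialBasis.repr.symm x) := by
  let U : lp (fun _ : ℕ × ℕ => ℂ) 2 →L[ℂ] hardySpace :=
    monomialBasis.repr.symm.toContinuousLinearEquiv
  have h : U ∘L shiftOperator s hs w hw = B ∘L U := by
    refine lp.ext_continuousLinearMap (by norm_num) fun k => ?_
    refine ContinuousLinearMap.ext_ring ?_
    change monomialBasis.repr.symm (shiftOperator s hs w hw (lp.single 2 k (1 : ℂ))) =
      B (monomialBasis.repr.symm (lp.single 2 k (1 : ℂ)))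
    rw [shiftOperator_single, map_smul, HilbertBasis.repr_symm_single,
      HilbertBasis.repr_symm_single, monomialBasis_apply, monomialBasis_apply, hB]
  exact DFunLike.congr_fun h x

lemma unitarilyEquivalentPairs_bergmanSphericalShift :
    UnitarilyEquivalentPairs bergmanSphericalShift.T₁ bergmanSphericalShift.T₂
      (mulCoord 0) (mulCoord 1) := by
  refine ⟨monomialBasis.repr.symm, repr_symm_shiftOperator _ _ fun k => ?_,
    repr_symm_shiftOperator _ _ fun k => ?_⟩
  · refine mulCoord_monomialVector (bergmanSphericalShift.α_pos k).le ?_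
      (bergmanSphericalShift.moment_add_fst k)
    simp only [monomialPoly, Prod.fst_add, Prod.snd_add, add_zero]
    ring
  · refine mulCoord_monomialVector (bergmanSphericalShift.β_pos k).le ?_
      (bergmanSphericalShift.moment_add_snd k)
    simp only [monomialPoly, Prod.fst_add, Prod.snd_add, add_zero]
    ring

end BergmanSIE

end

/-- The Bergman shift has exactly one spherically isometric embedding `W`, which is also the only
spherically isometric `2`-variable weighted shift with the Bergman shift as its `0`-th row. Its
moments, its Berger measure and its model on the Hardy space of the unit sphere of `ℂ²`. -/
theorem mainTheorem4 :
    ∃ W : BergmanSIE.TwoVariableWeightedShift,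
      (∀ W' : BergmanSIE.TwoVariableWeightedShift,
        BergmanSIE.IsSphericallyIsometricEmbedding BergmanSIE.bergmanShift W' ↔ W' = W) ∧
      (∀ W' : BergmanSIE.TwoVariableWeightedShift,
        (W'.IsSphericalIsometry ∧ ∀ n : ℕ, W'.α (n, 0) = BergmanSIE.bergmanShift.weight n) ↔
          W' = W) ∧
      (∀ k₁ k₂ : ℕ, W.moment (k₁, k₂) =
        ((k₁.factorial : ℝ) * (k₂.factorial : ℝ)) / ((k₁ + k₂ + 1).factorial : ℝ)) ∧
      (∀ μ : MeasureTheory.Measure (EuclideanSpace ℝ (Fin 2)),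
        W.IsBergerMeasure μ ↔
          μ = BergmanSIE.normalizedArclength BergmanSIE.unitSegment) ∧
      BergmanSIE.UnitarilyEquivalentPairs W.T₁ W.T₂
        (BergmanSIE.mulCoord 0) (BergmanSIE.mulCoord 1) := by
  exact ⟨BergmanSIE.bergmanSphericalShift,
    BergmanSIE.isSphericallyIsometricEmbedding_bergmanShift_iff,
    fun _ => ⟨fun h => h.1.eq_of_row BergmanSIE.isSphericalIsometry_bergmanSphericalShift
      fun n => (h.2 n).trans (BergmanSIE.bergmanSphericalShift_row n).symm,
      fun h => h ▸ ⟨BergmanSIE.isSphericalIsometry_bergmanSphericalShift,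
        BergmanSIE.bergmanSphericalShift_row⟩⟩,
    BergmanSIE.bergmanSphericalShift_moment,
    BergmanSIE.isBergerMeasure_bergmanSphericalShift_iff,
    BergmanSIE.unitarilyEquivalentPairs_bergmanSphericalShift⟩
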